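/- Let $d\ge 1$, $R>0$, $0<\lambda_{\min}<\lambda_{\max}$, and let $\mathcal X\subseteq\{x\in\mathbb R^d:\|x\|\le R\}$ be measurable. Let $\mathbb S_d^+(\lambda_{\min},\lambda_{\max})$ be the set of symmetric positive-definite $d\times d$ matrices with all eigenvalues in $[\lambda_{\min},\lambda_{\max}]$. For $\theta\in\mathcal X$ and $\Sigma\in\mathbb S_d^+(\lambda_{\min},\lambda_{\max})$ let $f(\cdot\mid\theta,\Sigma)$ be a probability density on $\mathbb R^d$, with $(x,\theta)\mapsto f(x\mid\theta,\Sigma)$ measurable. Let $\mathscr G$ be the set of all $G=P\times\delta_\Sigma$ with $P$ a Borel probability measure on $\mathbb R^d$ with $\mathrm{supp}(P)\subseteq\mathcal X$ and $\Sigma\in\mathbb S_d^+(\lambda_{\min},\lambda_{\max})$, and put $p_G(x)=\int f(x\mid\theta,\Sigma)\,P(d\theta)$ for $G\in\mathscr G$. Write $\|\cdot\|_{\mathrm{op}}$ for the operator norm, $\|\cdot\|_1$ for the $L^1$ norm with respect to Lebesgue measure, and $W_1$ for the Wasserstein distance of order one with Euclidean ground metric (the infimum of $\int\|\theta-\theta'\|\,d\pi$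 over couplings $\pi$). Assume the following. 1. There are a strictly increasing function $\Psi:[0,\infty)\to[0,\infty)$ and a constant $C_0>0$ such that $\|p_G-p_{G'}\|_1\ge C_0\,\Psi(\|\Sigma-\Sigma'\|_{\mathrm{op}})$ for all $G=P\times\delta_\Sigma$ and $G'=P'\times\delta_{\Sigma'}$ in $\mathscr G$. 2. (PDE inversion condition of order $\beta\in\mathbb N$.) There is a differential operator $\mathcal T_\Sigma=\sum_{\nu\in\mathbb N^d,\,|\nu|\le\beta}c_\nu(\Sigma)\,\partial^\nu$ such that: (i) for every $\Sigma\in\mathbb S_d^+(\lambda_{\min},\lambda_{\max})$ there is $\nu$ with $|\nu|=\beta$ and $c_\nu(\Sigma)\ne0$; (ii) there is $L>0$ such that $|c_\nu(\Sigma)-c_\nu(\Sigma')|\le L\|\Sigma-\Sigma'\|_{\mathrm{op}}$ for all $|\nu|\le\beta$ and all $\Sigma,\Sigma'\in\mathbb S_d^+(\lambda_{\min},\lambda_{\max})$; (iii) $\mathcal T_\Sigma p_G=P$ in the sense of distributions for every $G=P\times\delta_\Sigma\in\mathscr G$, that is, for all $\phi\in C_c^\infty(\mathbb R^d)$, $$\int_{\mathbb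 R^d} p_G(x)\sum_{|\nu|\le\beta}(-1)^{|\nu|}c_\nu(\Sigma)\,\partial^\nu\phi(x)\,dx=\int_{\mathbb R^d}\phi\,dP.$$ Then there are constants $C,C'>0$, depending only on $R,\lambda_{\min},\lambda_{\max},d$, the constant $C_0$ and the operator $\mathcal T_\Sigma$ (that is, $\beta$ and the coefficients $c_\nu$), but not otherwise on $\mathcal X$, $f$ or $\Psi$, such that $$\|p_G-p_{G'}\|_1\;\ge\; C'\Big[\Psi(\|\Sigma-\Sigma'\|_{\mathrm{op}})+\min\big\{W_1(P,P')^{\beta},\;\Psi\big(C\,W_1(P,P')^{\beta}\big)\big\}\Big]$$ for all $G=P\times\delta_\Sigma$ and $G'=P'\times\delta_{\Sigma'}$ in $\mathscr G$. In particular, the exponent $\beta$ of $W_1(P,P')$ does not involve the dimension $d$. -/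

import Mathlib

open MeasureTheory

noncomputable section

namespace PDEInv

/-- Euclidean space `ℝ^d` with the Euclidean norm. -/
abbrev Eu (d : ℕ) : Type := EuclideanSpace ℝ (Fin d)

/-- Real `d × d` matrices. -/
abbrev Mat (d : ℕ) : Type := Matrix (Fin d) (Fin d) ℝ

/-- The operator norm of a matrix acting on Euclidean space. -/
def opNorm {d : ℕ} (S : Mat d) : ℝ := ‖Matrix.toEuclideanCLM (n := Fin d) (𝕜 := ℝ) S‖

/-- Symmetric positive-definite matrices with all eigenvalues in `[lmin, lmax]`. -/
def scaleSet (d : ℕ) (lmin lmax : ℝ) : Set (Mat d) :=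
  {S | ∃ h : S.PosDef, ∀ i, lmin ≤ h.isHermitian.eigenvalues i ∧ h.isHermitian.eigenvalues i ≤ lmax}

/-- The mixing measures `G = P × δ_S`, encoded by the pair `(P, S)`: `P` is a probability measure
whose topological support lies in `X`, and `S` is an admissible scale matrix. -/
def mixingClass {d : ℕ} (X : Set (Eu d)) (lmin lmax : ℝ) : Set (Measure (Eu d) × Mat d) :=
  {G | IsProbabilityMeasure G.1 ∧ G.1.support ⊆ X ∧ G.2 ∈ scaleSet d lmin lmax}

/-- `f x θ S` stands for `f(x ∣ θ, S)`: for every admissible scale it is measurable in `(x, θ)`,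
and for every admissible location and scale it is a probability density in `x`. -/
def IsDensityKernel {d : ℕ} (X : Set (Eu d)) (lmin lmax : ℝ)
    (f : Eu d → Eu d → Mat d → ℝ) : Prop :=
  ∀ S ∈ scaleSet d lmin lmax,
    Measurable (fun z : Eu d × Eu d => f z.1 z.2 S) ∧
    ∀ θ ∈ X, (∀ x, 0 ≤ f x θ S) ∧ Integrable (fun x => f x θ S) ∧ ∫ x, f x θ S = 1

/-- The mixture density `p_G(x) = ∫ f(x ∣ θ, S) P(dθ)` for `G = P × δ_S`. -/
def mixDensity {d : ℕ} (f : Eu d → Eu d → Mat d → ℝ) (G : Measure (Eu d) × Mat d)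
    (x : Eu d) : ℝ :=
  ∫ θ, f x θ G.2 ∂G.1

/-- The `L¹` distance (Lebesgue measure) between two densities. -/
def l1Dist {d : ℕ} (p q : Eu d → ℝ) : ℝ := ∫ x, |p x - q x|

/-- The Wasserstein distance of order one with Euclidean ground metric: the infimum of the
transport cost over all couplings of `P` and `Q`. -/
def wassersteinOne {d : ℕ} (P Q : Measure (Eu d)) : ℝ :=
  (⨅ π : {π : Measure (Eu d × Eu d) // π.map Prod.fst = P ∧ π.map Prod.snd = Q},
    ∫⁻ z, edist z.1 z.2 ∂π.1).toReal

/-- The `L¹` distance of mixture densities dominates `C₀ Ψ(‖S - S'‖_op)`, where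
`Ψ : [0, ∞) → [0, ∞)` is strictly increasing (its values at negative arguments are irrelevant). -/
def ScaleLowerBound {d : ℕ} (X : Set (Eu d)) (lmin lmax : ℝ)
    (f : Eu d → Eu d → Mat d → ℝ) (Ψ : ℝ → ℝ) (C₀ : ℝ) : Prop :=
  (∀ t, 0 ≤ t → 0 ≤ Ψ t) ∧ StrictMonoOn Ψ (Set.Ici 0) ∧
  ∀ G ∈ mixingClass X lmin lmax, ∀ G' ∈ mixingClass X lmin lmax,
    C₀ * Ψ (opNorm (G.2 - G'.2)) ≤ l1Dist (mixDensity f G) (mixDensity f G')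

/-- The multi-indices `ν ∈ ℕ^d` with `|ν| ≤ β`. -/
def multiIndices (d β : ℕ) : Finset (Fin d → ℕ) :=
  (Fintype.piFinset fun _ => Finset.range (β + 1)).filter fun ν => ∑ i, ν i ≤ β

theorem mem_multiIndices {d β : ℕ} (ν : Fin d → ℕ) :
    ν ∈ multiIndices d β ↔ ∑ i, ν i ≤ β := by
  simp only [multiIndices, Finset.mem_filter, Fintype.mem_piFinset, Finset.mem_range,
    and_iff_right_iff_imp]
  intro h i
  have := Finset.single_le_sum (f := ν) (fun j _ => Nat.zero_le _) (Finset.mem_univ i)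
  omega

/-- The classical partial derivative `∂φ/∂x_i`. -/
def partialDeriv {d : ℕ} (i : Fin d) (φ : Eu d → ℝ) : Eu d → ℝ :=
  fun x => fderiv ℝ φ x (EuclideanSpace.single i 1)

/-- `∂^ν φ = ∂_1^{ν_1} ⋯ ∂_d^{ν_d} φ`, for smooth `φ`. -/
def multiDeriv {d : ℕ} (ν : Fin d → ℕ) (φ : Eu d → ℝ) : Eu d → ℝ :=
  (List.finRange d).foldr (fun i g => (partialDeriv i)^[ν i] g) φ

/-- The formal adjoint `T_S^* φ = ∑_{|ν| ≤ β} (-1)^{|ν|} c_ν(S) ∂^ν φ` of the differential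
operator `T_S = ∑_{|ν| ≤ β} c_ν(S) ∂^ν`. -/
def adjointOp {d : ℕ} (β : ℕ) (c : (Fin d → ℕ) → Mat d → ℝ) (S : Mat d)
    (φ : Eu d → ℝ) (x : Eu d) : ℝ :=
  ∑ ν ∈ multiIndices d β, (-1 : ℝ) ^ (∑ i, ν i) * c ν S * multiDeriv ν φ x

/-- The family of mixture densities satisfies the PDE inversion condition of order `β`, with the
differential operator `T_S = ∑_{|ν| ≤ β} c_ν(S) ∂^ν`: the operator has order exactly `β`, its
coefficients are Lipschitz in `S` with a common constant, and `T_S p_G = P` in the sense of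
distributions for every `G = P × δ_S` in the class. -/
structure PDEInversion {d : ℕ} (X : Set (Eu d)) (lmin lmax : ℝ)
    (f : Eu d → Eu d → Mat d → ℝ) (β : ℕ) (c : (Fin d → ℕ) → Mat d → ℝ) : Prop where
  order_eq : ∀ S ∈ scaleSet d lmin lmax, ∃ ν : Fin d → ℕ, ∑ i, ν i = β ∧ c ν S ≠ 0
  lipschitz : ∃ L : ℝ, 0 < L ∧ ∀ ν ∈ multiIndices d β,
    ∀ S ∈ scaleSet d lmin lmax, ∀ S' ∈ scaleSet d lmin lmax,
      |c ν S - c ν S'| ≤ L * opNorm (S - S')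
  inversion : ∀ G ∈ mixingClass X lmin lmax,
    ∀ φ : Eu d → ℝ, ContDiff ℝ (⊤ : ℕ∞) φ → HasCompactSupport φ →
      ∫ x, mixDensity f G x * adjointOp β c G.2 φ x = ∫ x, φ x ∂G.1

end PDEInv

end

/-! Write `ε` for the `L¹` distance of the mixtures, `δ` for the distance of the scales and `W` for
`W₁(P, P')`. The core is the Hölder estimate `W ^ β ≤ K (ε + δ)` (`exists_wassersteinOne_pow_le`).

By Kantorovich–Rubinstein duality (`wassersteinOne_le_of_forall_lipschitz`), `W` is controlled by `∫
h dP - ∫ h dP'` for 1-Lipschitz `h`. Cut `h` off outside the ball and mollify it at scale `1/s`.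
This costs `2/s`, and the result `φ` has derivatives up to order `β` of size only `s ^ (β - 1)`,
because the Lipschitz bound absorbs one derivative (`exists_mollification_bound`). Inversion turns
`∫ φ dP - ∫ φ dP'` into integrals of `p_G` and `p_G'` against adjoint operators applied to `φ`.
Since the coefficients are bounded and Lipschitz in the scale, the difference is at most a constant
times `s ^ (β - 1) (ε + δ)` (`integral_sub_integral_le`). Taking `s` proportional to `1/W` absorbs
`2/s` into `W/2` and leaves the estimate. Only sup norms of derivatives enter, so the exponent is
free of `d`.

For the theorem, `W ^ β ≤ 2K max(ε, δ)`. If `ε` is the larger, `W ^ β` is bounded by `ε` directly;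
if `δ` is, monotonicity of `Ψ` and the scale bound `C₀ Ψ(δ) ≤ ε` finish. The argument needs `β ≥ 1`;
order zero is impossible, because a point mass has no density. -/

noncomputable section

namespace PDEInv

/-! ### Kantorovich–Rubinstein duality on compact sets -/

/-- Finite Kantorovich duality. -/
theorem exists_coupling_weights {E ι : Type*} [PseudoMetricSpace E] [Fintype ι]
    (x : ι → E) (p q : ι → ℝ) (hp : ∀ i, 0 ≤ p i) (hq : ∀ i, 0 ≤ q i)
    (hp1 : ∑ i, p i = 1) (hq1 : ∑ i, q i = 1) (M : ℝ)
    (h : ∀ f : E → ℝ, LipschitzWith 1 f → ∑ i, p i * f (x i) - ∑ i, q i * f (x i) ≤ M) :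
    ∃ w : ι → ι → ℝ, (∀ i j, 0 ≤ w i j) ∧ (∀ i, ∑ j, w i j = p i) ∧ (∀ j, ∑ i, w i j = q j) ∧
      ∑ i, ∑ j, w i j * dist (x i) (x j) ≤ M := by
  classical
  by_contra hcon
  push Not at hcon
  have hne : Nonempty ι := by
    by_contra hι
    rw [not_nonempty_iff] at hι
    simp at hp1
  -- `T` sends weights to (row sums, column sums, cost). If every coupling costs more than `M`, then
  -- `(p, q, M)` lies outside the compact convex image of the simplex and can be strictly separated
  -- from it.
  let T : (ι × ι → ℝ) →ₗ[ℝ] (ι → ℝ) × (ι → ℝ) × ℝ :=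
    { toFun := fun w => (fun i => ∑ j, w (i, j), fun j => ∑ i, w (i, j),
        ∑ i, ∑ j, w (i, j) * dist (x i) (x j))
      map_add' := fun w w' => by
        ext <;> simp [Finset.sum_add_distrib, add_mul]
      map_smul' := fun r w => by
        ext <;> simp [Finset.mul_sum, mul_assoc] }
  have hTc : Continuous T := T.continuous_of_finiteDimensional
  have hK : IsCompact (T '' stdSimplex ℝ (ι × ι)) := (isCompact_stdSimplex ℝ (ι × ι)).image hTc
  have hKc : Convex ℝ (T '' stdSimplex ℝ (ι × ι)) := (convex_stdSimplex ℝ (ι × ι)).linear_image T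
  have hz : ((p, q, M) : (ι → ℝ) × (ι → ℝ) × ℝ) ∉ T '' stdSimplex ℝ (ι × ι) := by
    rintro ⟨w, hw, hT⟩
    have h1 : (fun i => ∑ j, w (i, j)) = p := congrArg Prod.fst hT
    have h2 : (fun j => ∑ i, w (i, j)) = q := congrArg (fun z => z.2.1) hT
    have h3 : ∑ i, ∑ j, w (i, j) * dist (x i) (x j) = M := congrArg (fun z => z.2.2) hT
    exact (hcon (fun i j => w (i, j)) (fun i j => hw.1 _) (congrFun h1) (congrFun h2)).ne h3.symm
  obtain ⟨g, u, hgK, hgz⟩ := geometric_hahn_banach_closed_point hKc hK.isClosed hz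
  set a : ι → ℝ := fun i => g (Pi.single i 1, 0, 0) with ha
  set b : ι → ℝ := fun i => g (0, Pi.single i 1, 0) with hb
  set r : ℝ := g (0, 0, 1) with hr
  have hg : ∀ (s t : ι → ℝ) (m : ℝ), g (s, t, m) = ∑ i, s i * a i + ∑ i, t i * b i + m * r := by
    intro s t m
    have h1 : ((s, t, m) : (ι → ℝ) × (ι → ℝ) × ℝ) =
        ∑ i, s i • (Pi.single i (1 : ℝ), (0 : ι → ℝ), (0 : ℝ)) +
          ∑ i, t i • ((0 : ι → ℝ), Pi.single i (1 : ℝ), (0 : ℝ)) + m • (0, 0, 1) := by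
      ext
      · simp [Prod.fst_sum, Finset.sum_apply, Pi.single_apply]
      · simp [Prod.fst_sum, Prod.snd_sum, Finset.sum_apply, Pi.single_apply]
      · simp [Prod.snd_sum]
    rw [h1]
    simp only [map_add, map_sum, map_smul, smul_eq_mul, ha, hb, hr]
  rw [hg] at hgz
  -- The product coupling has the same marginals as `(p, q, M)` but a larger cost, so separation
  -- forces a negative cost coordinate.
  have hr0 : r < 0 := by
    have hrow : ∀ i, ∑ j, p i * q j = p i := fun i => by rw [← Finset.mul_sum, hq1, mul_one]
    have hcol : ∀ j, ∑ i, p i * q j = q j := fun j => by rw [← Finset.sum_mul, hp1, one_mul]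
    have h1 := hcon (fun i j => p i * q j) (fun i j => mul_nonneg (hp i) (hq j)) hrow hcol
    have h2 := hgK _ ⟨fun z => p z.1 * q z.2, ⟨fun z => mul_nonneg (hp _) (hq _), by
      rw [Fintype.sum_prod_type]; simp_rw [hrow, hp1]⟩, rfl⟩
    have h3 : T (fun z => p z.1 * q z.2) =
        (p, q, ∑ i, ∑ j, p i * q j * dist (x i) (x j)) := by
      ext i
      · exact hrow i
      · exact hcol i
      · rfl
    rw [h3, hg] at h2
    by_contra hr
    push Not at hr
    have := mul_le_mul_of_nonneg_right h1.le hr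
    linarith
  -- Testing the vertices of the simplex gives the dual constraints on `(a, b)`.
  have hv : ∀ i j, a i + b j + dist (x i) (x j) * r < u := by
    intro i j
    have h2 := hgK _ ⟨Pi.single (i, j) 1, single_mem_stdSimplex ℝ (i, j), rfl⟩
    have h3 : T (Pi.single (i, j) 1) = (Pi.single i 1, Pi.single j 1, dist (x i) (x j)) := by
      ext k
      · simp [T, Pi.single_apply, Prod.ext_iff, ite_and, eq_comm]
      · simp [T, Pi.single_apply, Prod.ext_iff, ite_and, eq_comm]
      · simp [T, Pi.single_apply, Prod.ext_iff, ite_and, Finset.sum_ite_eq']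
    rw [h3, hg] at h2
    simpa [Pi.single_apply] using h2
  -- The `c`-transform of the dual potential, normalised by `-r`: automatically 1-Lipschitz, above
  -- `a / (-r)` and, by `hv`, below `(u - b) / (-r)` at the points.
  set f : E → ℝ := fun y => Finset.univ.sup' Finset.univ_nonempty
    (fun i => a i / (-r) - dist y (x i)) with hf
  have hfL : LipschitzWith 1 f := by
    refine LipschitzWith.of_le_add fun y z => ?_
    refine Finset.sup'_le _ _ fun i hi => ?_
    have h1 : a i / (-r) - dist z (x i) ≤ f z :=
      Finset.le_sup' (fun i => a i / (-r) - dist z (x i)) hi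
    have := dist_triangle_left z (x i) y
    linarith
  have hlow : ∀ i, a i / (-r) ≤ f (x i) := fun i => by
    have h1 : a i / (-r) - dist (x i) (x i) ≤ f (x i) :=
      Finset.le_sup' (fun k => a k / (-r) - dist (x i) (x k)) (Finset.mem_univ i)
    simpa using h1
  have hup : ∀ j, f (x j) ≤ (u - b j) / (-r) := fun j => by
    refine Finset.sup'_le _ _ fun i _ => ?_
    have h1 := hv i j
    rw [dist_comm, sub_le_iff_le_add, div_add' _ _ _ (by linarith), div_le_div_iff_of_pos_right
      (by linarith)]
    linarith
  have h1 := h f hfL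
  have h2 : ∑ i, p i * (a i / (-r)) ≤ ∑ i, p i * f (x i) :=
    Finset.sum_le_sum fun i _ => mul_le_mul_of_nonneg_left (hlow i) (hp i)
  have h3 : ∑ i, q i * f (x i) ≤ ∑ i, q i * ((u - b i) / (-r)) :=
    Finset.sum_le_sum fun i _ => mul_le_mul_of_nonneg_left (hup i) (hq i)
  have h4 : ∑ i, q i * ((u - b i) / (-r)) = (u - ∑ i, q i * b i) / (-r) := by
    simp_rw [mul_div_assoc', mul_sub]
    rw [← Finset.sum_div, Finset.sum_sub_distrib, ← Finset.sum_mul, hq1, one_mul]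
  have h5 : ∑ i, p i * (a i / (-r)) = (∑ i, p i * a i) / (-r) := by
    simp_rw [mul_div_assoc']
    rw [Finset.sum_div]
  have h6 : (∑ i, p i * a i) / (-r) - (u - ∑ i, q i * b i) / (-r) ≤ M := by linarith
  rw [← sub_div, div_le_iff₀ (by linarith)] at h6
  linarith

/-- A measurable quantisation of a compact set by finitely many points. -/
theorem exists_measurable_quantization {E : Type*} [PseudoMetricSpace E] [MeasurableSpace E]
    [OpensMeasurableSpace E] {K : Set E} (hK : IsCompact K) (hne : K.Nonempty)
    {η : ℝ} (hη : 0 < η) :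
    ∃ (N : ℕ) (e : Fin (N + 1) → E) (r : E → Fin (N + 1)), Measurable r ∧
      ∀ y ∈ K, dist (e (r y)) y ≤ η := by
  obtain ⟨t, htK, htf, hcov⟩ := Metric.finite_approx_of_totallyBounded hK.totallyBounded η hη
  obtain ⟨x₀, hx₀⟩ := hne
  have hc : t.Countable := htf.countable
  have htne : t.Nonempty := by
    obtain ⟨y, hy, -⟩ := Set.mem_iUnion₂.1 (hcov hx₀)
    exact ⟨y, hy⟩
  obtain ⟨e, rfl⟩ := hc.exists_eq_range htne
  obtain ⟨N, hN⟩ : ∃ N, ∀ y ∈ Set.range e, ∃ k ≤ N, e k = y := by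
    have h : ∀ y : Set.range e, ∃ k, e k = y := fun y => y.2
    choose k hk using h
    have := htf.fintype
    refine ⟨Finset.univ.sup k, fun y hy => ⟨k ⟨y, hy⟩, Finset.le_sup (Finset.mem_univ _), hk _⟩⟩
  refine ⟨N, fun i => e i, fun y => ⟨SimpleFunc.nearestPtInd e N y,
    Nat.lt_succ_of_le (SimpleFunc.nearestPtInd_le e N y)⟩, ?_, ?_⟩
  · refine measurable_to_countable' fun i => ?_
    have h := (SimpleFunc.nearestPtInd e N).measurableSet_fiber i
    convert h using 1
    ext y
    simp [Fin.ext_iff]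
  · intro y hy
    obtain ⟨z, hz, hyz⟩ := Set.mem_iUnion₂.1 (hcov hy)
    obtain ⟨k, hk, rfl⟩ := hN z hz
    have h := SimpleFunc.edist_nearestPt_le e y hk
    rw [edist_dist, edist_dist] at h
    have h' := (ENNReal.ofReal_le_ofReal_iff dist_nonneg).1 h
    rw [Metric.mem_ball, dist_comm] at hyz
    exact h'.trans hyz.le

theorem integrable_of_lipschitzWith_of_isCompact {E : Type*} [PseudoMetricSpace E]
    [MeasurableSpace E] [OpensMeasurableSpace E] {P : Measure E}
    [IsFiniteMeasure P] {K : Set E} (hK : IsCompact K) (hP : P Kᶜ = 0) {f : E → ℝ}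
    {L : NNReal} (hf : LipschitzWith L f) : Integrable f P := by
  obtain ⟨C, hC⟩ := hK.exists_bound_of_continuousOn hf.continuous.continuousOn
  refine Integrable.of_bound hf.continuous.measurable.aestronglyMeasurable C ?_
  have h : ∀ᵐ y ∂P, y ∈ K := mem_ae_iff.2 hP
  exact h.mono hC

/-- Integral of a function of a finite-valued random variable. -/
theorem integral_comp_eq_sum_fiber {E ι : Type*} [Fintype ι] [MeasurableSpace E]
    [MeasurableSpace ι] [MeasurableSingletonClass ι]
    {P : Measure E} [IsFiniteMeasure P] {r : E → ι} (hr : Measurable r) (f : ι → ℝ) :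
    ∫ y, f (r y) ∂P = ∑ i, P.real (r ⁻¹' {i}) * f i := by
  have hf : AEStronglyMeasurable f (P.map r) := by
    have : Finite ι := inferInstance
    exact (measurable_of_finite f).aestronglyMeasurable
  rw [← integral_map hr.aemeasurable hf, integral_fintype (Integrable.of_finite)]
  refine Finset.sum_congr rfl fun i _ => ?_
  rw [map_measureReal_apply hr (measurableSet_singleton i), smul_eq_mul]

theorem sum_measureReal_fiber {E ι : Type*} [Fintype ι] [MeasurableSpace E]
    [MeasurableSpace ι] [MeasurableSingletonClass ι]
    {P : Measure E} [IsProbabilityMeasure P] {r : E → ι} (hr : Measurable r) :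
    ∑ i, P.real (r ⁻¹' {i}) = 1 := by
  simpa using (integral_comp_eq_sum_fiber (P := P) hr (fun _ => 1)).symm

/-- The coupling of `P` and `Q` that transports conditional laws of the cells of a finite partition
independently, with the prescribed weights. -/
theorem exists_coupling_of_weights {E ι : Type*} [Fintype ι] [PseudoMetricSpace E]
    [MeasurableSpace E] [OpensMeasurableSpace E] [MeasurableSpace ι] [MeasurableSingletonClass ι]
    {P Q : Measure E} [IsProbabilityMeasure P] [IsProbabilityMeasure Q]
    {r : E → ι} (hr : Measurable r) (e : ι → E) {η : ℝ}
    (hP : ∀ᵐ y ∂P, dist (e (r y)) y ≤ η) (hQ : ∀ᵐ y ∂Q, dist (e (r y)) y ≤ η)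
    (w : ι → ι → ℝ) (hw : ∀ i j, 0 ≤ w i j)
    (hrow : ∀ i, ∑ j, w i j = P.real (r ⁻¹' {i})) (hcol : ∀ j, ∑ i, w i j = Q.real (r ⁻¹' {j})) :
    ∃ π : Measure (E × E), π.map Prod.fst = P ∧ π.map Prod.snd = Q ∧
      ∫⁻ z, edist z.1 z.2 ∂π ≤
        ENNReal.ofReal (∑ i, ∑ j, w i j * (dist (e i) (e j) + 2 * η)) := by
  classical
  set p : ι → Measure E := fun i => ProbabilityTheory.cond P (r ⁻¹' {i}) with hp
  set q : ι → Measure E := fun i => ProbabilityTheory.cond Q (r ⁻¹' {i}) with hq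
  have hmeas : ∀ i, MeasurableSet (r ⁻¹' {i}) := fun i => hr (measurableSet_singleton i)
  -- A null cell has no conditional law, but all of its weights vanish, so it contributes nothing.
  have hpprob : ∀ i j, w i j ≠ 0 → IsProbabilityMeasure (p i) := by
    intro i j hij
    refine ProbabilityTheory.cond_isProbabilityMeasure fun h0 => hij ?_
    have h1 : ∑ j, w i j = 0 := by rw [hrow, measureReal_def, h0]; simp
    exact (Finset.sum_eq_zero_iff_of_nonneg fun j _ => hw i j).1 h1 j (Finset.mem_univ _)
  have hqprob : ∀ i j, w i j ≠ 0 → IsProbabilityMeasure (q j) := by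
    intro i j hij
    refine ProbabilityTheory.cond_isProbabilityMeasure fun h0 => hij ?_
    have h1 : ∑ i, w i j = 0 := by rw [hcol, measureReal_def, h0]; simp
    exact (Finset.sum_eq_zero_iff_of_nonneg fun i _ => hw i j).1 h1 i (Finset.mem_univ _)
  have hsumP : ∑ i, ENNReal.ofReal (P.real (r ⁻¹' {i})) • p i = P := by
    simpa [ofReal_measureReal] using ProbabilityTheory.sum_meas_smul_cond_fiber hr P
  have hsumQ : ∑ i, ENNReal.ofReal (Q.real (r ⁻¹' {i})) • q i = Q := by
    simpa [ofReal_measureReal] using ProbabilityTheory.sum_meas_smul_cond_fiber hr Q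
  refine ⟨∑ i, ∑ j, ENNReal.ofReal (w i j) • (p i).prod (q j), ?_, ?_, ?_⟩
  · simp_rw [← Measure.mapₗ_apply_of_measurable measurable_fst, map_sum,
      Measure.mapₗ_apply_of_measurable measurable_fst, Measure.map_smul]
    rw [← hsumP]
    refine Finset.sum_congr rfl fun i _ => ?_
    rw [← hrow, ENNReal.ofReal_sum_of_nonneg fun j _ => hw i j, Finset.sum_smul]
    refine Finset.sum_congr rfl fun j _ => ?_
    by_cases h : w i j = 0
    · simp [h]
    · have := hqprob i j h
      rw [Measure.map_fst_prod, measure_univ, one_smul]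
  · simp_rw [← Measure.mapₗ_apply_of_measurable measurable_snd, map_sum,
      Measure.mapₗ_apply_of_measurable measurable_snd, Measure.map_smul]
    rw [← hsumQ, Finset.sum_comm]
    refine Finset.sum_congr rfl fun j _ => ?_
    rw [← hcol, ENNReal.ofReal_sum_of_nonneg fun i _ => hw i j, Finset.sum_smul]
    refine Finset.sum_congr rfl fun i _ => ?_
    by_cases h : w i j = 0
    · simp [h]
    · have := hpprob i j h
      rw [Measure.map_snd_prod, measure_univ, one_smul]
  · simp_rw [lintegral_finsetSum_measure, lintegral_smul_measure]
    have hterm : ∀ i j, 0 ≤ w i j * (dist (e i) (e j) + 2 * η) ∧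
        ENNReal.ofReal (w i j) • ∫⁻ z, edist z.1 z.2 ∂((p i).prod (q j)) ≤
          ENNReal.ofReal (w i j * (dist (e i) (e j) + 2 * η)) := by
      intro i j
      by_cases h : w i j = 0
      · simp [h]
      have := hpprob i j h
      have := hqprob i j h
      have h1 : ∀ᵐ y ∂(p i), dist (e i) y ≤ η := by
        filter_upwards [ProbabilityTheory.cond_absolutelyContinuous.ae_le hP,
          ProbabilityTheory.ae_cond_mem (hmeas i)] with y hy hy'
        rwa [← show r y = i from hy']
      have h2 : ∀ᵐ y ∂(q j), dist (e j) y ≤ η := by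
        filter_upwards [ProbabilityTheory.cond_absolutelyContinuous.ae_le hQ,
          ProbabilityTheory.ae_cond_mem (hmeas j)] with y hy hy'
        rwa [← show r y = j from hy']
      have hη : 0 ≤ η := by
        obtain ⟨y, hy⟩ := h1.exists
        exact dist_nonneg.trans hy
      have h3 : ∀ᵐ z ∂((p i).prod (q j)),
          edist z.1 z.2 ≤ ENNReal.ofReal (dist (e i) (e j) + 2 * η) := by
        filter_upwards [Measure.quasiMeasurePreserving_fst.ae h1,
          Measure.quasiMeasurePreserving_snd.ae h2] with z hz1 hz2
        rw [edist_dist]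
        refine ENNReal.ofReal_le_ofReal ?_
        have := dist_triangle4 z.1 (e i) (e j) z.2
        rw [dist_comm z.1 (e i)] at this
        linarith
      refine ⟨mul_nonneg (hw i j) (by positivity), ?_⟩
      rw [ENNReal.ofReal_mul (hw i j), smul_eq_mul]
      gcongr
      refine (lintegral_mono_ae h3).trans ?_
      simp
    rw [ENNReal.ofReal_sum_of_nonneg fun i _ => Finset.sum_nonneg fun j _ => (hterm i j).1]
    refine Finset.sum_le_sum fun i _ => ?_
    rw [ENNReal.ofReal_sum_of_nonneg fun j _ => (hterm i j).1]
    exact Finset.sum_le_sum fun j _ => (hterm i j).2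

/-- Kantorovich–Rubinstein duality for compactly supported measures. -/
theorem wassersteinOne_le_of_forall_lipschitz {d : ℕ} {P Q : Measure (Eu d)}
    [IsProbabilityMeasure P] [IsProbabilityMeasure Q] {K : Set (Eu d)} (hK : IsCompact K)
    (hP : P Kᶜ = 0) (hQ : Q Kᶜ = 0) {M : ℝ}
    (h : ∀ f : Eu d → ℝ, LipschitzWith 1 f → ∫ y, f y ∂P - ∫ y, f y ∂Q ≤ M) :
    wassersteinOne P Q ≤ M := by
  have hPK : ∀ᵐ y ∂P, y ∈ K := mem_ae_iff.2 hP
  have hQK : ∀ᵐ y ∂Q, y ∈ K := mem_ae_iff.2 hQ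
  have hM : 0 ≤ M := by simpa using h (fun _ => 0) (LipschitzWith.const' 0)
  refine le_of_forall_pos_le_add fun ε hε => ?_
  -- Four errors of size `η`: one for discretising each of `P` and `Q`, and two for moving within
  -- the cells at both ends of the transport.
  set η : ℝ := ε / 4 with hη
  have hηpos : 0 < η := by positivity
  obtain ⟨y₀, hy₀⟩ := hPK.exists
  obtain ⟨N, e, r, hr, her⟩ := exists_measurable_quantization hK ⟨y₀, hy₀⟩ hηpos
  have hPr := hPK.mono her
  have hQr := hQK.mono her
  have key : ∀ (μ : Measure (Eu d)) [IsProbabilityMeasure μ], μ Kᶜ = 0 →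
      (∀ᵐ y ∂μ, dist (e (r y)) y ≤ η) → ∀ f : Eu d → ℝ, LipschitzWith 1 f →
      |∑ i, μ.real (r ⁻¹' {i}) * f (e i) - ∫ y, f y ∂μ| ≤ η := by
    intro μ _ hμ hμr f hf
    have hi : Integrable (fun y => f (e (r y))) μ :=
      Integrable.of_bound ((measurable_of_finite fun i => f (e i)).comp hr).aestronglyMeasurable
        (∑ i, |f (e i)|) (Filter.Eventually.of_forall fun y =>
          Finset.single_le_sum (f := fun i => |f (e i)|) (fun i _ => abs_nonneg _)
            (Finset.mem_univ (r y)))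
    rw [← integral_comp_eq_sum_fiber hr (fun i => f (e i)),
      ← integral_sub hi (integrable_of_lipschitzWith_of_isCompact hK hμ hf), ← Real.norm_eq_abs]
    refine (norm_integral_le_of_norm_le_const (C := η) ?_).trans (by simp)
    filter_upwards [hμr] with y hy
    have := hf.dist_le_mul (e (r y)) y
    simp only [NNReal.coe_one, one_mul] at this
    rw [Real.norm_eq_abs, ← Real.dist_eq]
    exact this.trans hy
  obtain ⟨w, hw, hrow, hcol, hcost⟩ := exists_coupling_weights e (fun i => P.real (r ⁻¹' {i}))
    (fun i => Q.real (r ⁻¹' {i})) (fun i => measureReal_nonneg) (fun i => measureReal_nonneg)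
    (sum_measureReal_fiber hr) (sum_measureReal_fiber hr) (M + 2 * η) (fun f hf => by
      have h1 := (abs_le.1 (key P hP hPr f hf)).2
      have h2 := (abs_le.1 (key Q hQ hQr f hf)).1
      have h3 := h f hf
      linarith)
  obtain ⟨π, hπ1, hπ2, hπ⟩ := exists_coupling_of_weights hr e hPr hQr w hw hrow hcol
  have hsum : ∑ i, ∑ j, w i j * (dist (e i) (e j) + 2 * η) ≤ M + ε := by
    have : ∑ i, ∑ j, w i j = 1 := by
      simp_rw [hrow]; exact sum_measureReal_fiber hr
    simp_rw [mul_add, Finset.sum_add_distrib, ← Finset.sum_mul, this]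
    linarith
  refine ENNReal.toReal_le_of_le_ofReal (by positivity) ?_
  exact (iInf_le _ ⟨π, hπ1, hπ2⟩).trans (hπ.trans (ENNReal.ofReal_le_ofReal hsum))

/-! ### Smooth test functions: iterated derivatives, mollification, cutoff -/

variable {d : ℕ}

/-- Carries the order and two functions differentiated in parallel, so that an identity involving a
power of the scale can be followed through all derivatives. -/
theorem multiDeriv_induction₂ {p : ℕ → (Eu d → ℝ) → (Eu d → ℝ) → Prop} (ν : Fin d → ℕ)
    {φ ψ : Eu d → ℝ} (h0 : p 0 φ ψ)
    (hs : ∀ i n g h, p n g h → p (n + 1) (partialDeriv i g) (partialDeriv i h)) :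
    p (∑ i, ν i) (multiDeriv ν φ) (multiDeriv ν ψ) := by
  rw [Fin.sum_univ_def]
  unfold multiDeriv
  induction List.finRange d with
  | nil => simpa using h0
  | cons i l ih =>
    simp only [List.map_cons, List.sum_cons, List.foldr_cons]
    induction ν i with
    | zero => simpa using ih
    | succ n ihn =>
      rw [Function.iterate_succ_apply', Function.iterate_succ_apply', Nat.add_right_comm]
      exact hs _ _ _ _ ihn

theorem multiDeriv_induction {p : (Eu d → ℝ) → Prop} (ν : Fin d → ℕ)
    {φ : Eu d → ℝ} (h0 : p φ) (hs : ∀ i g, p g → p (partialDeriv i g)) : p (multiDeriv ν φ) :=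
  multiDeriv_induction₂ (p := fun _ g _ => p g) (ψ := φ) ν h0 fun i _ g _ hg => hs i g hg

theorem contDiff_partialDeriv {φ : Eu d → ℝ} (hφ : ContDiff ℝ (⊤ : ℕ∞) φ) (i : Fin d) :
    ContDiff ℝ (⊤ : ℕ∞) (partialDeriv i φ) :=
  (hφ.fderiv_right (m := (⊤ : ℕ∞)) (by simp)).clm_apply contDiff_const

theorem hasCompactSupport_partialDeriv {φ : Eu d → ℝ} (hφ : HasCompactSupport φ) (i : Fin d) :
    HasCompactSupport (partialDeriv i φ) :=
  hφ.fderiv_apply ℝ _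

theorem multiDeriv_contDiff_hasCompactSupport {φ : Eu d → ℝ} (hφ : ContDiff ℝ (⊤ : ℕ∞) φ)
    (hc : HasCompactSupport φ) (ν : Fin d → ℕ) :
    ContDiff ℝ (⊤ : ℕ∞) (multiDeriv ν φ) ∧ HasCompactSupport (multiDeriv ν φ) :=
  multiDeriv_induction (p := fun g => ContDiff ℝ (⊤ : ℕ∞) g ∧ HasCompactSupport g) ν ⟨hφ, hc⟩
    fun i _ hg => ⟨contDiff_partialDeriv hg.1 i, hasCompactSupport_partialDeriv hg.2 i⟩

/-- The convolution of two real functions on Euclidean space. -/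
def conv (g u : Eu d → ℝ) (x : Eu d) : ℝ := ∫ t, g t * u (x - t)

open scoped Convolution in
theorem conv_eq (g u : Eu d → ℝ) :
    conv g u = g ⋆[ContinuousLinearMap.lsmul ℝ ℝ, volume] u := rfl

theorem integrable_mul_comp_sub {g u : Eu d → ℝ} (hg : Continuous g) (hc : HasCompactSupport g)
    (hu : Continuous u) (x : Eu d) : Integrable fun t => g t * u (x - t) :=
  Continuous.integrable_of_hasCompactSupport (by fun_prop) (hc.mul_right)

theorem contDiff_conv {g u : Eu d → ℝ} (hg : ContDiff ℝ (⊤ : ℕ∞) g) (hc : HasCompactSupport g)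
    (hu : Continuous u) : ContDiff ℝ (⊤ : ℕ∞) (conv g u) := by
  rw [conv_eq]
  exact hc.contDiff_convolution_left _ hg hu.locallyIntegrable

theorem partialDeriv_conv {g u : Eu d → ℝ} (hg : ContDiff ℝ (⊤ : ℕ∞) g) (hc : HasCompactSupport g)
    (hu : Continuous u) (i : Fin d) :
    partialDeriv i (conv g u) = conv (partialDeriv i g) u := by
  funext x
  have hg1 : ContDiff ℝ 1 g := hg.of_le (by exact_mod_cast le_top)
  have h := hc.hasFDerivAt_convolution_left (ContinuousLinearMap.lsmul ℝ ℝ) hg1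
    (μ := volume) (hu.locallyIntegrable) x
  rw [← conv_eq] at h
  unfold partialDeriv
  rw [h.fderiv, convolution, ContinuousLinearMap.integral_apply]
  · rfl
  · exact (hc.fderiv ℝ).convolutionExists_left _ (hg1.continuous_fderiv (by norm_num))
      hu.locallyIntegrable x

/-- Convolution with the constant `1` is constant, and its derivative is the integral of the
derivative. -/
theorem integral_partialDeriv_eq_zero {g : Eu d → ℝ} (hg : ContDiff ℝ (⊤ : ℕ∞) g)
    (hc : HasCompactSupport g) (i : Fin d) : ∫ t, partialDeriv i g t = 0 := by
  have h := congrFun (partialDeriv_conv hg hc (continuous_const (y := (1 : ℝ))) i) 0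
  simp only [conv, mul_one] at h
  rw [← h, partialDeriv, show conv g (fun _ => 1) = fun _ => ∫ t, g t by funext x; simp [conv]]
  simp

theorem partialDeriv_scale {h : Eu d → ℝ} (hh : ContDiff ℝ (⊤ : ℕ∞) h) (a s : ℝ) (i : Fin d) :
    partialDeriv i (fun x => a * h (s • x)) = fun x => a * s * partialDeriv i h (s • x) := by
  funext x
  have h1 : HasFDerivAt h (fderiv ℝ h (s • x)) (s • x) :=
    (hh.differentiable (by simp) _).hasFDerivAt
  have h2 : HasFDerivAt (fun x : Eu d => s • x) (s • ContinuousLinearMap.id ℝ (Eu d)) x :=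
    (hasFDerivAt_id x).const_smul s
  have h3 := (h1.comp x h2).const_mul a
  unfold partialDeriv
  rw [show (fun x => a * h (s • x)) = fun y => a * (h ∘ fun x => s • x) y from rfl, h3.fderiv]
  simp [mul_assoc]

theorem multiDeriv_scale_conv {ρ u : Eu d → ℝ} (hρ : ContDiff ℝ (⊤ : ℕ∞) ρ)
    (hc : HasCompactSupport ρ) (hu : Continuous u) (a s : ℝ) (ν : Fin d → ℕ) :
    multiDeriv ν (fun x => a * conv ρ u (s • x)) =
      fun x => a * s ^ (∑ i, ν i) * conv (multiDeriv ν ρ) u (s • x) := by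
  refine (multiDeriv_induction₂ (p := fun n g h => ContDiff ℝ (⊤ : ℕ∞) g ∧ HasCompactSupport g ∧
    h = fun x => a * s ^ n * conv g u (s • x)) (φ := ρ)
    (ψ := fun x => a * conv ρ u (s • x)) ν ⟨hρ, hc, by simp⟩ ?_).2.2
  rintro i n g h ⟨hg, hgc, rfl⟩
  refine ⟨contDiff_partialDeriv hg i, hasCompactSupport_partialDeriv hgc i, ?_⟩
  rw [partialDeriv_scale (contDiff_conv hg hgc hu), partialDeriv_conv hg hgc hu]
  simp [pow_succ, mul_assoc]

theorem integral_multiDeriv_eq_zero {g : Eu d → ℝ} (hg : ContDiff ℝ (⊤ : ℕ∞) g)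
    (hc : HasCompactSupport g) {ν : Fin d → ℕ} (hν : ∑ i, ν i ≠ 0) :
    ∫ t, multiDeriv ν g t = 0 := by
  refine (multiDeriv_induction₂ (p := fun n g _ => ContDiff ℝ (⊤ : ℕ∞) g ∧ HasCompactSupport g ∧
    (n ≠ 0 → ∫ t, g t = 0)) (φ := g) (ψ := g) ν ⟨hg, hc, fun h => (h rfl).elim⟩ ?_).2.2 hν
  rintro i n g - ⟨hg, hgc, -⟩
  exact ⟨contDiff_partialDeriv hg i, hasCompactSupport_partialDeriv hgc i,
    fun _ => integral_partialDeriv_eq_zero hg hgc i⟩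

theorem multiDeriv_of_sum_eq_zero {ν : Fin d → ℕ} (hν : ∑ i, ν i = 0) (φ : Eu d → ℝ) :
    multiDeriv ν φ = φ := by
  have h := multiDeriv_induction₂ (p := fun n g _ => n = 0 → g = φ) (φ := φ) (ψ := φ) ν
    (fun _ => rfl) (fun i n g h _ hn => by simp at hn)
  exact h hν

/-- Used twice: with the mollifier it is the approximation error, and with a mean-zero derivative of
the mollifier it bounds a derivative by a first moment, independently of the size of `u`. -/
theorem abs_conv_sub_le {g u : Eu d → ℝ} (hg : Continuous g) (hc : HasCompactSupport g)
    (hu : LipschitzWith 1 u) (y : Eu d) :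
    |conv g u y - (∫ t, g t) * u y| ≤ ∫ t, |g t| * ‖t‖ := by
  rw [conv, ← integral_mul_const, ← integral_sub (integrable_mul_comp_sub hg hc hu.continuous y)
    ((hg.integrable_of_hasCompactSupport hc).mul_const _), ← Real.norm_eq_abs]
  refine norm_integral_le_of_norm_le (Continuous.integrable_of_hasCompactSupport (by fun_prop)
    (hc.norm.mul_right)) (Filter.Eventually.of_forall fun t => ?_)
  rw [← mul_sub, Real.norm_eq_abs, abs_mul]
  gcongr
  have := hu.dist_le_mul (y - t) y
  rw [Real.dist_eq] at this
  simpa [dist_eq_norm] using this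

theorem abs_conv_le {g u : Eu d → ℝ} (hg : Continuous g) (hc : HasCompactSupport g)
    {B : ℝ} (hu : ∀ y, |u y| ≤ B) (y : Eu d) :
    |conv g u y| ≤ (∫ t, |g t|) * B := by
  rw [conv, ← integral_mul_const, ← Real.norm_eq_abs]
  refine norm_integral_le_of_norm_le
    ((hg.integrable_of_hasCompactSupport hc).abs.mul_const _)
    (Filter.Eventually.of_forall fun t => ?_)
  rw [Real.norm_eq_abs, abs_mul]
  gcongr
  exact hu _

theorem exists_mollifier (d : ℕ) : ∃ ρ : Eu d → ℝ, ContDiff ℝ (⊤ : ℕ∞) ρ ∧ HasCompactSupport ρ ∧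
    ∫ t, ρ t = 1 ∧ ∫ t, |ρ t| = 1 ∧ ∫ t, |ρ t| * ‖t‖ ≤ 1 := by
  let b : ContDiffBump (0 : Eu d) := ⟨1 / 2, 1, by norm_num, by norm_num⟩
  have hcont : Continuous (b.normed volume) := b.continuous_normed
  have habs : ∀ t, |b.normed volume t| = b.normed volume t := fun t =>
    abs_of_nonneg (b.nonneg_normed t)
  refine ⟨b.normed volume, b.contDiff_normed, b.hasCompactSupport_normed, b.integral_normed,
    ?_, ?_⟩
  · simp_rw [habs]; exact b.integral_normed
  · simp_rw [habs]
    rw [← b.integral_normed (μ := volume)]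
    refine integral_mono (Continuous.integrable_of_hasCompactSupport (by fun_prop)
      (b.hasCompactSupport_normed.mul_right)) b.integrable_normed fun t => ?_
    by_cases ht : t ∈ Function.support (b.normed volume)
    · rw [b.support_normed_eq] at ht
      have : ‖t‖ ≤ 1 := by simpa using (Metric.mem_ball.1 ht).le
      exact mul_le_of_le_one_right (b.nonneg_normed t) this
    · rw [Function.notMem_support] at ht
      simp [ht]

/-- Smoothing a compactly supported `1`-Lipschitz function at scale `1 / s`. -/
theorem exists_mollification_bound (d m : ℕ) : ∃ K : ℝ, 0 ≤ K ∧
    ∀ (B s : ℝ), 0 ≤ B → 1 ≤ s → ∀ g : Eu d → ℝ, LipschitzWith 1 g → HasCompactSupport g →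
      (∀ x, |g x| ≤ B) →
      ∃ φ : Eu d → ℝ, ContDiff ℝ (⊤ : ℕ∞) φ ∧ HasCompactSupport φ ∧ (∀ x, |φ x - g x| ≤ s⁻¹) ∧
        ∀ ν ∈ multiIndices d (m + 1), ∀ x, |multiDeriv ν φ x| ≤ (K + B) * s ^ m := by
  obtain ⟨ρ, hρ, hρc, hρ1, hρabs, hρmom⟩ := exists_mollifier d
  have hK : ∀ ν : Fin d → ℕ, 0 ≤ ∫ t, |multiDeriv ν ρ t| * ‖t‖ := fun ν =>
    integral_nonneg fun t => by positivity
  refine ⟨∑ ν ∈ multiIndices d (m + 1), ∫ t, |multiDeriv ν ρ t| * ‖t‖,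
    Finset.sum_nonneg fun ν _ => hK ν, ?_⟩
  intro B s hB hs g hg hgc hgB
  have hs0 : 0 < s := by linarith
  -- Rescaling by `s` preserves the Lipschitz constant, so one fixed mollifier serves all scales.
  set u : Eu d → ℝ := fun y => s * g (s⁻¹ • y) with hu
  have huL : LipschitzWith 1 u := by
    refine LipschitzWith.of_dist_le_mul fun y z => ?_
    have h1 := hg.dist_le_mul (s⁻¹ • y) (s⁻¹ • z)
    rw [dist_smul₀, Real.norm_of_nonneg (by positivity), Real.dist_eq] at h1
    simp only [NNReal.coe_one, one_mul] at h1 ⊢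
    rw [Real.dist_eq, hu, ← mul_sub, abs_mul, abs_of_pos hs0]
    calc s * |g (s⁻¹ • y) - g (s⁻¹ • z)| ≤ s * (s⁻¹ * dist y z) := by gcongr
      _ = dist y z := by field_simp
  have huB : ∀ y, |u y| ≤ s * B := fun y => by
    rw [hu, abs_mul, abs_of_pos hs0]
    exact mul_le_mul_of_nonneg_left (hgB _) hs0.le
  have huc : HasCompactSupport u := (hgc.comp_smul (inv_ne_zero hs0.ne')).mul_left
  have hus : ∀ x, s⁻¹ * u (s • x) = g x := fun x => by
    simp only [hu, smul_smul, inv_mul_cancel₀ hs0.ne', one_smul]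
    field_simp
  refine ⟨fun x => s⁻¹ * conv ρ u (s • x), ?_, ?_, fun x => ?_, fun ν hν x => ?_⟩
  · exact contDiff_const.mul ((contDiff_conv hρ hρc huL.continuous).comp
      (contDiff_const_smul s))
  · refine HasCompactSupport.mul_left (f := fun _ => s⁻¹) ?_
    exact HasCompactSupport.comp_smul (by rw [conv_eq]; exact hρc.convolution _ huc) hs0.ne'
  · rw [← hus x, ← mul_sub, abs_mul, abs_of_pos (inv_pos.2 hs0)]
    have h1 := abs_conv_sub_le hρ.continuous hρc huL (s • x)
    rw [hρ1, one_mul] at h1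
    exact mul_le_of_le_one_right (by positivity) (h1.trans hρmom)
  · rw [multiDeriv_scale_conv hρ hρc huL.continuous]
    obtain ⟨hνs, hνc⟩ := multiDeriv_contDiff_hasCompactSupport hρ hρc ν
    rw [mem_multiIndices] at hν
    have hKle : ∫ t, |multiDeriv ν ρ t| * ‖t‖ ≤
        ∑ ν ∈ multiIndices d (m + 1), ∫ t, |multiDeriv ν ρ t| * ‖t‖ :=
      Finset.single_le_sum (f := fun ν => ∫ t, |multiDeriv ν ρ t| * ‖t‖)
        (fun ν _ => hK ν) ((mem_multiIndices ν).2 hν)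
    by_cases h0 : ∑ i, ν i = 0
    · rw [h0, multiDeriv_of_sum_eq_zero h0, pow_zero, mul_one, abs_mul,
        abs_of_pos (inv_pos.2 hs0)]
      have h1 := abs_conv_le hρ.continuous hρc huB (s • x)
      rw [hρabs, one_mul] at h1
      calc s⁻¹ * |conv ρ u (s • x)| ≤ s⁻¹ * (s * B) := by gcongr
        _ = B := by field_simp
        _ ≤ (∑ ν ∈ multiIndices d (m + 1), ∫ t, |multiDeriv ν ρ t| * ‖t‖) + B := by
          linarith [hK ν]
        _ ≤ _ := le_mul_of_one_le_right (by linarith [hK ν]) (one_le_pow₀ hs)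
    -- The prefactor `s⁻¹` cancels one of the `|ν|` powers of `s`; this is the gain from `m + 1` to
    -- `m`.
    · have h1 := abs_conv_sub_le hνs.continuous hνc huL (s • x)
      rw [integral_multiDeriv_eq_zero hρ hρc h0, zero_mul, sub_zero] at h1
      have h2 : s⁻¹ * s ^ (∑ i, ν i) ≤ s ^ m := by
        calc s⁻¹ * s ^ (∑ i, ν i) ≤ s⁻¹ * s ^ (m + 1) := by gcongr
          _ = s ^ m := by rw [pow_succ]; field_simp
      rw [abs_mul, abs_of_nonneg (by positivity), mul_comm]
      refine mul_le_mul (by linarith) h2 (by positivity) (by linarith [hK ν])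

/-- A `1`-Lipschitz function can be cut off outside a ball without increasing its Lipschitz
constant. -/
theorem exists_lipschitz_cutoff {f : Eu d → ℝ} (hf : LipschitzWith 1 f) {R : ℝ} (hR : 0 ≤ R) :
    ∃ g : Eu d → ℝ, LipschitzWith 1 g ∧ HasCompactSupport g ∧ (∀ x, |g x| ≤ 2 * R) ∧
      ∀ x ∈ Metric.closedBall (0 : Eu d) R, g x = f x - f 0 := by
  -- Clamping `f - f 0` between `±h` is inactive on the ball, where `|f x - f 0| ≤ ‖x‖ ≤ R ≤ 2R -
  -- ‖x‖`.
  set h : Eu d → ℝ := fun x => max 0 (2 * R - ‖x‖) with hh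
  have hhL : LipschitzWith 1 h := by
    have h1 : LipschitzWith 1 fun x : Eu d => 2 * R - ‖x‖ :=
      LipschitzWith.of_le_add fun x y => by
        have := norm_sub_norm_le y x
        rw [dist_comm, dist_eq_norm]
        linarith
    exact h1.const_max 0
  have hfL : LipschitzWith 1 fun x => f x - f 0 := LipschitzWith.of_le_add fun x y => by
    have := hf.le_add_mul x y
    simp only [NNReal.coe_one, one_mul] at this
    linarith
  have hh0 : ∀ x, 0 ≤ h x := fun x => le_max_left _ _
  refine ⟨fun x => max (-(h x)) (min (f x - f 0) (h x)), ?_, ?_, fun x => ?_, fun x hx => ?_⟩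
  · simpa using (hhL.neg).max (hfL.min hhL)
  · refine HasCompactSupport.intro (isCompact_closedBall (0 : Eu d) (2 * R)) fun x hx => ?_
    have h1 : h x = 0 := by
      rw [Metric.mem_closedBall, dist_zero_right, not_le] at hx
      exact max_eq_left (by linarith)
    simp [h1]
  · have h1 : h x ≤ 2 * R := max_le (by linarith) (by linarith [norm_nonneg x])
    refine abs_le.2 ⟨le_max_of_le_left (by linarith), max_le (by linarith [hh0 x]) ?_⟩
    exact (min_le_right _ _).trans h1
  · rw [Metric.mem_closedBall, dist_zero_right] at hx
    have h1 := hf.dist_le_mul x 0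
    rw [Real.dist_eq, dist_zero_right, NNReal.coe_one, one_mul] at h1
    have h2 : ‖x‖ ≤ h x := le_max_of_le_right (by linarith)
    have h3 := abs_le.1 h1
    simp only
    rw [min_eq_left (by linarith), max_eq_right (by linarith)]

/-! ### Testing the inversion formula -/

theorem integrable_mixDensity {X : Set (Eu d)} {lmin lmax : ℝ}
    {f : Eu d → Eu d → Mat d → ℝ} (hf : IsDensityKernel X lmin lmax f)
    {G : Measure (Eu d) × Mat d} (hG : G ∈ mixingClass X lmin lmax) :
    Integrable (mixDensity f G) ∧ ∫ x, |mixDensity f G x| ≤ 1 := by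
  obtain ⟨P, S⟩ := G
  obtain ⟨hP, hsupp, hS⟩ := hG
  obtain ⟨hmeas, hdens⟩ := hf S hS
  dsimp only at hP hsupp hS
  -- The kernel is a density only for locations in `X`, which carries all the mass of `P`.
  have hX : ∀ᵐ θ ∂P, θ ∈ X := Filter.mem_of_superset Measure.support_mem_ae hsupp
  have hnorm : ∀ᵐ θ ∂P, ∫ x, ‖f x θ S‖ = 1 := by
    filter_upwards [hX] with θ hθ
    simp_rw [Real.norm_of_nonneg ((hdens θ hθ).1 _)]
    exact (hdens θ hθ).2.2
  have hint : Integrable (fun z : Eu d × Eu d => f z.1 z.2 S) (volume.prod P) := by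
    rw [integrable_prod_iff' hmeas.aestronglyMeasurable]
    refine ⟨hX.mono fun θ hθ => (hdens θ hθ).2.1, ?_⟩
    exact (integrable_const (1 : ℝ)).congr (hnorm.mono fun θ hθ => hθ.symm)
  refine ⟨hint.integral_prod_left, ?_⟩
  have hint' : Integrable (fun z : Eu d × Eu d => ‖f z.1 z.2 S‖) (volume.prod P) := hint.norm
  calc ∫ x, |mixDensity f (P, S) x| ≤ ∫ x, ∫ θ, ‖f x θ S‖ ∂P :=
        integral_mono hint.integral_prod_left.abs hint'.integral_prod_left
          fun x => norm_integral_le_integral_norm fun θ => f x θ S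
    _ = ∫ θ, (∫ x, ‖f x θ S‖) ∂P := integral_integral_swap hint'
    _ = ∫ θ, 1 ∂P := integral_congr_ae hnorm
    _ = 1 := by simp

theorem continuous_adjointOp {φ : Eu d → ℝ} (hφ : ContDiff ℝ (⊤ : ℕ∞) φ)
    (hc : HasCompactSupport φ) (β : ℕ) (c : (Fin d → ℕ) → Mat d → ℝ) (S : Mat d) :
    Continuous (adjointOp β c S φ) := by
  unfold adjointOp
  exact continuous_finsetSum _ fun ν _ => continuous_const.mul
    (multiDeriv_contDiff_hasCompactSupport hφ hc ν).1.continuous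

theorem abs_adjointOp_le {β : ℕ} {c : (Fin d → ℕ) → Mat d → ℝ} {S : Mat d} {φ : Eu d → ℝ}
    {A D : ℝ} (hA : ∀ ν ∈ multiIndices d β, |c ν S| ≤ A) {x : Eu d}
    (hD : ∀ ν ∈ multiIndices d β, |multiDeriv ν φ x| ≤ D) :
    |adjointOp β c S φ x| ≤ (multiIndices d β).card * (A * D) := by
  rw [← nsmul_eq_mul]
  refine (Finset.abs_sum_le_sum_abs _ _).trans (Finset.sum_le_card_nsmul _ _ _ fun ν hν => ?_)
  rw [abs_mul, abs_mul, abs_pow, abs_neg, abs_one, one_pow, one_mul]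
  exact mul_le_mul (hA ν hν) (hD ν hν) (abs_nonneg _) ((abs_nonneg _).trans (hA ν hν))

theorem adjointOp_sub (β : ℕ) (c : (Fin d → ℕ) → Mat d → ℝ) (S S' : Mat d) (φ : Eu d → ℝ)
    (x : Eu d) : adjointOp β c S φ x - adjointOp β c S' φ x =
      adjointOp β (fun ν _ => c ν S - c ν S') S φ x := by
  unfold adjointOp
  rw [← Finset.sum_sub_distrib]
  exact Finset.sum_congr rfl fun ν _ => by ring

/-- Stability of the inversion formula, tested against a smooth function with bounded
derivatives. -/
theorem integral_sub_integral_le {X : Set (Eu d)} {lmin lmax : ℝ}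
    {f : Eu d → Eu d → Mat d → ℝ} {β : ℕ} {c : (Fin d → ℕ) → Mat d → ℝ}
    (hf : IsDensityKernel X lmin lmax f) (hinv : PDEInversion X lmin lmax f β c)
    {G G' : Measure (Eu d) × Mat d} (hG : G ∈ mixingClass X lmin lmax)
    (hG' : G' ∈ mixingClass X lmin lmax) {A B D : ℝ}
    (hA : ∀ ν ∈ multiIndices d β, |c ν G.2| ≤ A)
    (hB : ∀ ν ∈ multiIndices d β, |c ν G.2 - c ν G'.2| ≤ B)
    {φ : Eu d → ℝ} (hφ : ContDiff ℝ (⊤ : ℕ∞) φ) (hc : HasCompactSupport φ)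
    (hD : ∀ ν ∈ multiIndices d β, ∀ x, |multiDeriv ν φ x| ≤ D) :
    ∫ x, φ x ∂G.1 - ∫ x, φ x ∂G'.1 ≤ (multiIndices d β).card * D *
      (A * l1Dist (mixDensity f G) (mixDensity f G') + B) := by
  obtain ⟨hp, -⟩ := integrable_mixDensity hf hG
  obtain ⟨hp', hp'1⟩ := integrable_mixDensity hf hG'
  set p := mixDensity f G
  set p' := mixDensity f G'
  set a := adjointOp β c G.2 φ
  set a' := adjointOp β c G'.2 φ
  have ha : ∀ x, |a x| ≤ (multiIndices d β).card * (A * D) := fun x =>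
    abs_adjointOp_le hA fun ν hν => hD ν hν x
  have haa : ∀ x, |a x - a' x| ≤ (multiIndices d β).card * (B * D) := fun x => by
    rw [adjointOp_sub]
    exact abs_adjointOp_le (c := fun ν _ => c ν G.2 - c ν G'.2) hB fun ν hν => hD ν hν x
  have hac : Continuous a := continuous_adjointOp hφ hc β c G.2
  have hac' : Continuous a' := continuous_adjointOp hφ hc β c G'.2
  have hi1 : Integrable fun x => (p x - p' x) * a x :=
    (hp.sub hp').mul_bdd hac.aestronglyMeasurable (Filter.Eventually.of_forall ha)
  have hi2 : Integrable fun x => p' x * (a x - a' x) :=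
    hp'.mul_bdd (hac.sub hac').aestronglyMeasurable (Filter.Eventually.of_forall haa)
  have hi3 : Integrable fun x => p x * a x :=
    hp.mul_bdd hac.aestronglyMeasurable (Filter.Eventually.of_forall ha)
  have hi4 : Integrable fun x => p' x * a' x := by
    refine (hi3.sub (hi1.add hi2)).congr (Filter.Eventually.of_forall fun x => ?_)
    simp only [Pi.sub_apply, Pi.add_apply]
    ring
  rw [← hinv.inversion G hG φ hφ hc, ← hinv.inversion G' hG' φ hφ hc, ← integral_sub hi3 hi4]
  -- One term sees only the change of density, the other only the change of coefficients.
  have h0 : ∫ x, (p x * a x - p' x * a' x) =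
      (∫ x, (p x - p' x) * a x) + ∫ x, p' x * (a x - a' x) := by
    rw [← integral_add hi1 hi2]
    exact integral_congr_ae (Filter.Eventually.of_forall fun x => by ring)
  have h1 : ∫ x, (p x - p' x) * a x ≤ l1Dist p p' * ((multiIndices d β).card * (A * D)) := by
    rw [l1Dist, ← integral_mul_const]
    refine integral_mono hi1 ((hp.sub hp').abs.mul_const _) fun x => (le_abs_self _).trans ?_
    simp only [abs_mul]
    exact mul_le_mul_of_nonneg_left (ha x) (abs_nonneg _)
  have h2 : ∫ x, p' x * (a x - a' x) ≤ (∫ x, |p' x|) * ((multiIndices d β).card * (B * D)) := by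
    rw [← integral_mul_const]
    refine integral_mono hi2 (hp'.abs.mul_const _) fun x => (le_abs_self _).trans ?_
    simp only [abs_mul]
    exact mul_le_mul_of_nonneg_left (haa x) (abs_nonneg _)
  have h3 : 0 ≤ (multiIndices d β).card * (B * D) := (abs_nonneg _).trans (haa 0)
  have h4 := mul_le_mul_of_nonneg_right hp'1 h3
  change ∫ x, (p x * a x - p' x * a' x) ≤ _
  rw [h0]
  linarith

/-! ### Uniform bounds over the class -/

theorem opNorm_le_of_mem_scaleSet {lmin lmax : ℝ} (hlmin : 0 ≤ lmin) (hlmax : 0 ≤ lmax) {S : Mat d}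
    (hS : S ∈ scaleSet d lmin lmax) : opNorm S ≤ lmax := by
  obtain ⟨h, hev⟩ := hS
  have h1 := h.isHermitian.spectral_theorem
  open scoped Matrix.Norms.L2Operator in
  have h2 : ‖S‖ ≤ lmax := by
    rw [h1, Unitary.conjStarAlgAut_apply]
    rw [CStarRing.norm_mul_mem_unitary _ (Unitary.star_mem h.isHermitian.eigenvectorUnitary.2),
      CStarRing.norm_coe_unitary_mul, Matrix.l2_opNorm_diagonal]
    refine (pi_norm_le_iff_of_nonneg hlmax).2 fun i => ?_
    have := hev i
    simp only [Function.comp_apply, RCLike.ofReal_real_eq_id, id_eq, Real.norm_eq_abs]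
    exact abs_le.2 ⟨by linarith, this.2⟩
  exact h2

theorem opNorm_sub_le (S S' : Mat d) : opNorm (S - S') ≤ opNorm S + opNorm S' := by
  unfold opNorm
  rw [map_sub]
  exact norm_sub_le _ _

/-- A Lipschitz function on a bounded set is bounded; the bound depends on the operator and the
spectral range alone. -/
theorem exists_coeff_bound {lmin lmax : ℝ} (hlmin : 0 ≤ lmin) (hlmax : 0 ≤ lmax) {β : ℕ}
    {c : (Fin d → ℕ) → Mat d → ℝ} {L : ℝ} (hL : 0 ≤ L)
    (hc : ∀ ν ∈ multiIndices d β, ∀ S ∈ scaleSet d lmin lmax, ∀ S' ∈ scaleSet d lmin lmax,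
      |c ν S - c ν S'| ≤ L * opNorm (S - S')) :
    ∃ A : ℝ, 0 ≤ A ∧ ∀ ν ∈ multiIndices d β, ∀ S ∈ scaleSet d lmin lmax, |c ν S| ≤ A := by
  rcases (scaleSet d lmin lmax).eq_empty_or_nonempty with h | ⟨S₀, hS₀⟩
  · exact ⟨0, le_rfl, by simp [h]⟩
  refine ⟨∑ ν ∈ multiIndices d β, |c ν S₀| + L * (lmax + lmax), by positivity,
    fun ν hν S hS => ?_⟩
  have h1 := hc ν hν S hS S₀ hS₀
  have h2 : L * opNorm (S - S₀) ≤ L * (lmax + lmax) :=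
    mul_le_mul_of_nonneg_left ((opNorm_sub_le S S₀).trans
      (add_le_add (opNorm_le_of_mem_scaleSet hlmin hlmax hS)
        (opNorm_le_of_mem_scaleSet hlmin hlmax hS₀))) hL
  have h3 : |c ν S₀| ≤ ∑ ν ∈ multiIndices d β, |c ν S₀| :=
    Finset.single_le_sum (f := fun ν => |c ν S₀|) (fun _ _ => abs_nonneg _) hν
  have h4 := abs_sub_abs_le_abs_sub (c ν S) (c ν S₀)
  linarith

theorem ae_mem_closedBall_of_mem_mixingClass {X : Set (Eu d)} {lmin lmax R : ℝ}
    (hX : X ⊆ Metric.closedBall 0 R) {G : Measure (Eu d) × Mat d}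
    (hG : G ∈ mixingClass X lmin lmax) : ∀ᵐ y ∂G.1, y ∈ Metric.closedBall (0 : Eu d) R :=
  Filter.mem_of_superset Measure.support_mem_ae (hG.2.1.trans hX)

/-- Keeps the smoothing parameter, which is inversely proportional to the distance, above `1`. -/
theorem wassersteinOne_le_two_mul_radius {P Q : Measure (Eu d)} [IsProbabilityMeasure P]
    [IsProbabilityMeasure Q] {R : ℝ} (hP : ∀ᵐ y ∂P, y ∈ Metric.closedBall (0 : Eu d) R)
    (hQ : ∀ᵐ y ∂Q, y ∈ Metric.closedBall (0 : Eu d) R) : wassersteinOne P Q ≤ 2 * R := by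
  refine wassersteinOne_le_of_forall_lipschitz (isCompact_closedBall 0 R) (mem_ae_iff.1 hP)
    (mem_ae_iff.1 hQ) fun f hf => ?_
  have key : ∀ (μ : Measure (Eu d)) [IsProbabilityMeasure μ],
      (∀ᵐ y ∂μ, y ∈ Metric.closedBall (0 : Eu d) R) → |∫ y, f y ∂μ - f 0| ≤ R := by
    intro μ _ hμ
    have hi := integrable_of_lipschitzWith_of_isCompact (isCompact_closedBall 0 R)
      (mem_ae_iff.1 hμ) hf
    have h1 : ∫ y, f y ∂μ - f 0 = ∫ y, (f y - f 0) ∂μ := by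
      rw [integral_sub hi (integrable_const _)]; simp
    rw [h1, ← Real.norm_eq_abs]
    refine (norm_integral_le_of_norm_le_const (C := R) ?_).trans (by simp)
    filter_upwards [hμ] with y hy
    have := hf.dist_le_mul y 0
    rw [NNReal.coe_one, one_mul] at this
    exact this.trans hy
  have h1 := (abs_le.1 (key P hP)).2
  have h2 := (abs_le.1 (key Q hQ)).1
  linarith

/-! ### The smoothing estimate -/

/-- The smoothing estimate for the Wasserstein distance, with `s⁻¹` the smoothing scale. -/
theorem exists_wassersteinOne_smoothing_bound (d m : ℕ) : ∃ K : ℝ, 0 ≤ K ∧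
    ∀ {X : Set (Eu d)} {lmin lmax R : ℝ} {f : Eu d → Eu d → Mat d → ℝ}
      {c : (Fin d → ℕ) → Mat d → ℝ} {G G' : Measure (Eu d) × Mat d} {A B s : ℝ},
      0 ≤ R → X ⊆ Metric.closedBall 0 R → IsDensityKernel X lmin lmax f →
      PDEInversion X lmin lmax f (m + 1) c →
      G ∈ mixingClass X lmin lmax → G' ∈ mixingClass X lmin lmax →
      (∀ ν ∈ multiIndices d (m + 1), |c ν G.2| ≤ A) →
      (∀ ν ∈ multiIndices d (m + 1), |c ν G.2 - c ν G'.2| ≤ B) → 1 ≤ s →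
      wassersteinOne G.1 G'.1 ≤ 2 * s⁻¹ + (multiIndices d (m + 1)).card *
        ((K + 2 * R) * s ^ m) * (A * l1Dist (mixDensity f G) (mixDensity f G') + B) := by
  obtain ⟨K, hK, hmoll⟩ := exists_mollification_bound d m
  refine ⟨K, hK, ?_⟩
  intro X lmin lmax R f c G G' A B s hR hX hf hinv hG hG' hA hB hs
  have hP := ae_mem_closedBall_of_mem_mixingClass hX hG
  have hP' := ae_mem_closedBall_of_mem_mixingClass hX hG'
  have := hG.1
  have := hG'.1
  refine wassersteinOne_le_of_forall_lipschitz (isCompact_closedBall 0 R) (mem_ae_iff.1 hP)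
    (mem_ae_iff.1 hP') fun h hh => ?_
  obtain ⟨g, hg, hgc, hgB, hgeq⟩ := exists_lipschitz_cutoff hh hR
  obtain ⟨φ, hφ, hφc, hφg, hφD⟩ := hmoll (2 * R) s (by positivity) hs g hg hgc hgB
  have hmain := integral_sub_integral_le hf hinv hG hG' hA hB hφ hφc hφD
  have key : ∀ (μ : Measure (Eu d)) [IsProbabilityMeasure μ],
      (∀ᵐ y ∂μ, y ∈ Metric.closedBall (0 : Eu d) R) →
      |∫ y, φ y ∂μ - (∫ y, h y ∂μ - h 0)| ≤ s⁻¹ := by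
    intro μ _ hμ
    have hi := integrable_of_lipschitzWith_of_isCompact (isCompact_closedBall 0 R)
      (mem_ae_iff.1 hμ) hh
    have hφi : Integrable φ μ := hφ.continuous.integrable_of_hasCompactSupport hφc
    have hgi : Integrable g μ := hg.continuous.integrable_of_hasCompactSupport hgc
    have h1 : ∫ y, h y ∂μ - h 0 = ∫ y, g y ∂μ := by
      rw [integral_congr_ae (hμ.mono hgeq), integral_sub hi (integrable_const _)]; simp
    rw [h1, ← integral_sub hφi hgi, ← Real.norm_eq_abs]
    exact (norm_integral_le_of_norm_le_const (C := s⁻¹)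
      (Filter.Eventually.of_forall hφg)).trans (by simp)
  have h1 := (abs_le.1 (key G.1 hP)).1
  have h2 := (abs_le.1 (key G'.1 hP')).2
  linarith

/-! ### Impossibility of order zero -/

theorem adjointOp_order_zero (c : (Fin d → ℕ) → Mat d → ℝ) (S : Mat d) (φ : Eu d → ℝ) (x : Eu d) :
    adjointOp 0 c S φ x = c 0 S * φ x := by
  have h : multiIndices d 0 = {0} := by
    ext ν
    rw [mem_multiIndices, Finset.mem_singleton]
    simp [funext_iff]
  rw [adjointOp, h, Finset.sum_singleton, multiDeriv_of_sum_eq_zero (by simp)]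
  simp

/-- The inversion formula cannot hold at order zero, since point masses have no density. -/
theorem notMem_mixingClass_of_order_zero (hd : 0 < d) {X : Set (Eu d)} {lmin lmax : ℝ}
    {f : Eu d → Eu d → Mat d → ℝ} {c : (Fin d → ℕ) → Mat d → ℝ}
    (hf : IsDensityKernel X lmin lmax f) (hinv : PDEInversion X lmin lmax f 0 c)
    (G : Measure (Eu d) × Mat d) : G ∉ mixingClass X lmin lmax := by
  intro hG
  have := hG.1
  have : Nonempty (Fin d) := ⟨⟨0, hd⟩⟩
  obtain ⟨θ, hθ⟩ : G.1.support.Nonempty := by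
    have h : ∀ᵐ y ∂G.1, y ∈ G.1.support := Measure.support_mem_ae
    exact h.exists
  set S := G.2
  have hδ : (Measure.dirac θ, S) ∈ mixingClass X lmin lmax := by
    refine ⟨Measure.dirac.isProbabilityMeasure, ?_, hG.2.2⟩
    refine (Measure.support_subset_of_isClosed (isClosed_singleton (x := θ)) ?_).trans
      (Set.singleton_subset_iff.2 (hG.2.1 hθ))
    rw [mem_ae_iff, Measure.dirac_apply' _ (measurableSet_singleton θ).compl]
    simp
  obtain ⟨hp, -⟩ := integrable_mixDensity hf hδ
  set p := mixDensity f (Measure.dirac θ, S)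
  have hpos : ∀ n : ℕ, (0 : ℝ) < 1 / (n + 1) := fun n => Nat.one_div_pos_of_nat
  -- Bumps shrinking to `θ`: tested on the point mass they give `1`, while against an integrable
  -- density their integrals tend to `0`.
  let b : ℕ → ContDiffBump θ := fun n => ⟨1 / (n + 1) / 2, 1 / (n + 1), half_pos (hpos n),
    half_lt_self (hpos n)⟩
  have hone : ∀ n, ∫ x, p x * (c 0 S * b n x) = 1 := fun n => by
    have h := hinv.inversion _ hδ (b n) (b n).contDiff (b n).hasCompactSupport
    simp only [adjointOp_order_zero, integral_dirac] at h
    rw [h]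
    exact (b n).one_of_mem_closedBall (Metric.mem_closedBall_self (b n).rIn_pos.le)
  have hlim : Filter.Tendsto (fun n => ∫ x, p x * (c 0 S * b n x)) Filter.atTop
      (nhds (∫ _ : Eu d, (0 : ℝ))) := by
    refine tendsto_integral_of_dominated_convergence (fun x => |p x| * |c 0 S|)
      (fun n => hp.aestronglyMeasurable.mul
        (continuous_const.mul (b n).continuous).aestronglyMeasurable)
      (hp.abs.mul_const _) (fun n => Filter.Eventually.of_forall fun x => ?_) ?_
    · rw [Real.norm_eq_abs, abs_mul, abs_mul, abs_of_nonneg (b n).nonneg]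
      exact mul_le_mul_of_nonneg_left (mul_le_of_le_one_right (abs_nonneg _) (b n).le_one)
        (abs_nonneg _)
    · have hae : ∀ᵐ x : Eu d, x ≠ θ := by
        rw [ae_iff]; simp
      filter_upwards [hae] with x hx
      refine tendsto_const_nhds.congr' ?_
      obtain ⟨N, hN⟩ := exists_nat_one_div_lt (dist_pos.2 hx)
      filter_upwards [Filter.eventually_ge_atTop N] with n hn
      have h1 : (1 : ℝ) / (n + 1) ≤ dist x θ := (Nat.one_div_le_one_div hn).trans hN.le
      rw [(b n).zero_of_le_dist h1, mul_zero, mul_zero]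
  simp only [hone, integral_zero] at hlim
  exact one_ne_zero (tendsto_nhds_unique tendsto_const_nhds hlim)

/-! ### The Hölder estimate -/

theorem wassersteinOne_nonneg (P Q : Measure (Eu d)) : 0 ≤ wassersteinOne P Q :=
  ENNReal.toReal_nonneg

theorem l1Dist_nonneg (p q : Eu d → ℝ) : 0 ≤ l1Dist p q :=
  integral_nonneg fun _ => abs_nonneg _

theorem opNorm_nonneg (S : Mat d) : 0 ≤ opNorm S := norm_nonneg _

/-- The Wasserstein distance is Hölder-controlled by the `L¹` distance of the mixtures and the
distance of the scales. -/
theorem exists_wassersteinOne_pow_le {R lmin lmax : ℝ} (hR : 0 < R) (hlmin : 0 ≤ lmin)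
    (hlmax : 0 ≤ lmax) (m : ℕ) {c : (Fin d → ℕ) → Mat d → ℝ}
    (hc : ∃ L : ℝ, 0 < L ∧ ∀ ν ∈ multiIndices d (m + 1),
      ∀ S ∈ scaleSet d lmin lmax, ∀ S' ∈ scaleSet d lmin lmax,
        |c ν S - c ν S'| ≤ L * opNorm (S - S')) :
    ∃ K : ℝ, 0 < K ∧ ∀ {X : Set (Eu d)} {f : Eu d → Eu d → Mat d → ℝ}
      {G G' : Measure (Eu d) × Mat d}, X ⊆ Metric.closedBall 0 R → IsDensityKernel X lmin lmax f →
      PDEInversion X lmin lmax f (m + 1) c →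
      G ∈ mixingClass X lmin lmax → G' ∈ mixingClass X lmin lmax →
      wassersteinOne G.1 G'.1 ^ (m + 1) ≤
        K * (l1Dist (mixDensity f G) (mixDensity f G') + opNorm (G.2 - G'.2)) := by
  obtain ⟨L, hL, hc⟩ := hc
  obtain ⟨A, hA, hcA⟩ := exists_coeff_bound hlmin hlmax hL.le hc
  obtain ⟨K, hK, hsm⟩ := exists_wassersteinOne_smoothing_bound d m
  set H : ℝ := (multiIndices d (m + 1)).card * (K + 2 * R) with hH
  have hH0 : 0 ≤ H := by positivity
  refine ⟨2 * H * (4 + 2 * R) ^ m * (A + L) + 1, by positivity, ?_⟩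
  intro X f G G' hX hf hinv hG hG'
  have := hG.1
  have := hG'.1
  set W := wassersteinOne G.1 G'.1 with hWdef
  set ε := l1Dist (mixDensity f G) (mixDensity f G')
  set δ := opNorm (G.2 - G'.2)
  have hε : 0 ≤ ε := l1Dist_nonneg _ _
  have hδ : 0 ≤ δ := opNorm_nonneg _
  rcases (wassersteinOne_nonneg G.1 G'.1).eq_or_lt with hW | hW
  · rw [hWdef, ← hW, zero_pow (Nat.succ_ne_zero m)]
    positivity
  have hWR : W ≤ 2 * R := wassersteinOne_le_two_mul_radius
    (ae_mem_closedBall_of_mem_mixingClass hX hG) (ae_mem_closedBall_of_mem_mixingClass hX hG')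
  -- With `s = (4 + 2R) / W` the smoothing error `2/s` is at most `W / 2`, and `W ≤ 2R` makes `s ≥
  -- 1`.
  have hs : 1 ≤ (4 + 2 * R) / W := by rw [one_le_div hW]; linarith
  have h1 := hsm hR.le hX hf hinv hG hG' (fun ν hν => hcA ν hν _ hG.2.2)
    (fun ν hν => hc ν hν _ hG.2.2 _ hG'.2.2) hs
  change W ≤ 2 * ((4 + 2 * R) / W)⁻¹ + _ * (_ * ((4 + 2 * R) / W) ^ m) * (A * ε + L * δ) at h1
  have h2 : 2 * ((4 + 2 * R) / W)⁻¹ ≤ W / 2 := by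
    rw [inv_div, mul_div_assoc', div_le_div_iff₀ (by linarith) two_pos]
    nlinarith
  have h3 : A * ε + L * δ ≤ (A + L) * (ε + δ) := by
    nlinarith [mul_nonneg hA hδ, mul_nonneg hL.le hε]
  have h4 : W / 2 ≤ H * ((4 + 2 * R) / W) ^ m * ((A + L) * (ε + δ)) := by
    have h5 := mul_le_mul_of_nonneg_left h3
      (show 0 ≤ H * ((4 + 2 * R) / W) ^ m by positivity)
    rw [hH] at h5 ⊢
    linarith
  rw [div_pow, mul_div_assoc', div_mul_eq_mul_div, le_div_iff₀ (by positivity)] at h4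
  rw [pow_succ]
  nlinarith

end PDEInv

end

/-! ### Conclusion -/

theorem theorem3p5 (d : ℕ) (hd : 0 < d) (R lmin lmax : ℝ) (hR : 0 < R) (hlmin : 0 < lmin)
    (hlt : lmin < lmax) (β : ℕ)
    (c : (Fin d → ℕ) → Matrix (Fin d) (Fin d) ℝ → ℝ) (C₀ : ℝ) (hC₀ : 0 < C₀) :
    ∃ C C' : ℝ, 0 < C ∧ 0 < C' ∧
      ∀ (X : Set (PDEInv.Eu d)), MeasurableSet X → X ⊆ Metric.closedBall 0 R →
      ∀ (f : PDEInv.Eu d → PDEInv.Eu d → PDEInv.Mat d → ℝ) (Ψ : ℝ → ℝ),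
        PDEInv.IsDensityKernel X lmin lmax f →
        PDEInv.ScaleLowerBound X lmin lmax f Ψ C₀ →
        PDEInv.PDEInversion X lmin lmax f β c →
        ∀ G ∈ PDEInv.mixingClass X lmin lmax, ∀ G' ∈ PDEInv.mixingClass X lmin lmax,
          C' * (Ψ (PDEInv.opNorm (G.2 - G'.2)) +
              min (PDEInv.wassersteinOne G.1 G'.1 ^ β)
                (Ψ (C * PDEInv.wassersteinOne G.1 G'.1 ^ β))) ≤
            PDEInv.l1Dist (PDEInv.mixDensity f G) (PDEInv.mixDensity f G') := by
  open PDEInv in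
  cases β with
  | zero =>
    exact ⟨1, 1, one_pos, one_pos, fun X _ _ f Ψ hf _ hinv G hG =>
      (notMem_mixingClass_of_order_zero hd hf hinv G hG).elim⟩
  | succ m =>
    -- The constants must be chosen before `X`, `f` and `Ψ`; the Lipschitz condition concerns `c`
    -- alone, and if it fails the inversion hypothesis is never met.
    by_cases hc : ∃ L : ℝ, 0 < L ∧ ∀ ν ∈ multiIndices d (m + 1),
      ∀ S ∈ scaleSet d lmin lmax, ∀ S' ∈ scaleSet d lmin lmax,
        |c ν S - c ν S'| ≤ L * opNorm (S - S')
    swap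
    · exact ⟨1, 1, one_pos, one_pos, fun X _ _ f Ψ _ _ hinv => (hc hinv.lipschitz).elim⟩
    obtain ⟨K, hK, hW⟩ := exists_wassersteinOne_pow_le hR hlmin.le (hlmin.trans hlt).le m hc
    have hk : 0 < min (1 / (2 * K)) C₀ := lt_min (by positivity) hC₀
    -- Each summand is bounded separately with constant `min (1 / (2K)) C₀`; halving it allows the
    -- two bounds to be added.
    refine ⟨1 / (2 * K), min (1 / (2 * K)) C₀ / 2, by positivity, by positivity, ?_⟩
    intro X _ hX f Ψ hf hΨ hinv G hG G' hG'
    have hpow := hW hX hf hinv hG hG'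
    obtain ⟨hΨ0, hΨmono, hlow⟩ := hΨ
    have hε := hlow G hG G' hG'
    set w := wassersteinOne G.1 G'.1 ^ (m + 1)
    set ε := l1Dist (mixDensity f G) (mixDensity f G')
    set δ := opNorm (G.2 - G'.2)
    have hw : 0 ≤ w := pow_nonneg (wassersteinOne_nonneg _ _) _
    have hδ : 0 ≤ δ := opNorm_nonneg _
    have h1 : min (1 / (2 * K)) C₀ * Ψ δ ≤ ε :=
      (mul_le_mul_of_nonneg_right (min_le_right _ _) (hΨ0 δ hδ)).trans hε
    have hCw : 0 ≤ 1 / (2 * K) * w := by positivity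
    have h2 : min (1 / (2 * K)) C₀ * min w (Ψ (1 / (2 * K) * w)) ≤ ε := by
      have hmax : 1 / (2 * K) * w ≤ max ε δ := by
        rw [one_div_mul_eq_div, div_le_iff₀ (by positivity)]
        nlinarith [le_max_left ε δ, le_max_right ε δ]
      rcases le_total δ ε with h | h
      · rw [max_eq_left h] at hmax
        exact (mul_le_mul (min_le_left _ _) (min_le_left _ _) (le_min hw (hΨ0 _ hCw))
          (by positivity)).trans hmax
      · rw [max_eq_right h] at hmax
        have h3 : Ψ (1 / (2 * K) * w) ≤ Ψ δ := hΨmono.monotoneOn hCw hδ hmax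
        exact (mul_le_mul (min_le_right _ _) ((min_le_right _ _).trans h3)
          (le_min hw (hΨ0 _ hCw)) hC₀.le).trans hε
    linarith
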